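/- Let $N\in\mathbb N$, let $\mathcal H=L^2_{\mathbb C}(\mathbb R^N,d^Nx)$, and for $(q,p)\in\mathbb R^N\times\mathbb R^N=\mathbb R^{2N}$ let $U_{qp}$ be the unitary operator $(U_{qp}u)(x)=e^{ip\cdot x}u(x-q)$ on $\mathcal H$. Let $K(\mathcal H)$ denote the set of density operators (positive trace-class operators of trace $1$). An *observable* on a measurable space $(M,\Xi)$ is a map $F$ from $\Xi$ to the bounded operators on $\mathcal H$ with $0\le F(B)\le 1$ for all $B\in\Xi$, $F(\emptyset)=0$, $F(M)=1$, and $\operatorname{tr}(WF(\bigcup_n B_n))=\sum_n\operatorname{tr}(WF(B_n))$ for all $W\in K(\mathcal H)$ and all sequences of pairwise disjoint $B_n\in\Xi$. It is *statistically complete* if, for $W_1,W_2\in K(\mathcal H)$, $\operatorname{tr}(W_1F(B))=\operatorname{tr}(W_2F(B))$ for all $B\in\Xi$ implies $W_1=W_2$. **Theorem.** Let $a\in K(\mathcal H)$ and $a_{qp}=U_{qp}\,a\,U_{qp}^*$. For every Borel set $B\subseteq\mathbb R^{2N}$ the integral $$F(B)=\frac1{(2\pi)^N}\int_B a_{qp}\,d^Nq\,d^Np$$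 exists in the weak sense (that is, $\langle\varphi,F(B)\psi\rangle=(2\pi)^{-N}\int_B\langle\varphi,a_{qp}\psi\rangle\,d^Nq\,d^Np$ with absolutely convergent integrals for all $\varphi,\psi\in\mathcal H$), and $F$ is an observable on $\mathbb R^{2N}$ with its Borel $\sigma$-algebra (the joint position-momentum observable generated by $a$). If $$\operatorname{tr}(aU_{qp})\neq0\quad\text{for almost all }(q,p)\in\mathbb R^{2N},$$ then $F$ is statistically complete. In particular, for all $\sigma_1,\dots,\sigma_N>0$ the Gaussian function $u(x)=\prod_{j=1}^N(2\pi\sigma_j^2)^{-1/4}e^{-x_j^2/(4\sigma_j^2)}$ gives a density operator $a=|u\rangle\langle u|$ with $\operatorname{tr}(aU_{qp})\neq0$ for all $(q,p)\in\mathbb R^{2N}$, so that the joint position-momentum observable generated by it is statistically complete. -/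

import Mathlib

open MeasureTheory
open scoped InnerProductSpace

noncomputable section

namespace PhaseSpace

/-! ### Trace, density operators, observables on a complex Hilbert space -/

section Abstract

variable {H : Type*} [NormedAddCommGroup H] [InnerProductSpace ℂ H]

variable {M : Type*} [MeasurableSpace M]

/-- `A` is the weak integral of the operator-valued function `f` with respect to `μ`. -/
def HasWeakIntegral (μ : Measure M) (f : M → H →L[ℂ] H) (A : H →L[ℂ] H) : Prop :=
  ∀ φ ψ : H, Integrable (fun z => ⟪φ, f z ψ⟫_ℂ) μ ∧ ⟪φ, A ψ⟫_ℂ = ∫ z, ⟪φ, f z ψ⟫_ℂ ∂μ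

open Classical in
/-- The weak integral of `f` (which is unique) if it exists, and `0` otherwise. -/
def weakIntegral (μ : Measure M) (f : M → H →L[ℂ] H) : H →L[ℂ] H :=
  if h : ∃ A, HasWeakIntegral μ f A then h.choose else 0

theorem HasWeakIntegral.unique {μ : Measure M} {f : M → H →L[ℂ] H} {A A' : H →L[ℂ] H}
    (h : HasWeakIntegral μ f A) (h' : HasWeakIntegral μ f A') : A = A' := by
  ext1 ψ
  exact ext_inner_left ℂ fun φ => (h φ ψ).2.trans (h' φ ψ).2.symm

theorem HasWeakIntegral.weakIntegral_eq {μ : Measure M} {f : M → H →L[ℂ] H} {A : H →L[ℂ] H}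
    (h : HasWeakIntegral μ f A) : weakIntegral μ f = A := by
  have hex : ∃ A, HasWeakIntegral μ f A := ⟨A, h⟩
  rw [weakIntegral, dif_pos hex]
  exact hex.choose_spec.unique h

/-- The index set of the orthonormal basis `refBasis H`. -/
def refIndex (H : Type*) [NormedAddCommGroup H] [InnerProductSpace ℂ H] [CompleteSpace H] :
    Set H :=
  (exists_hilbertBasis ℂ H).choose

/-- Some orthonormal basis of `H`, fixed once and for all. -/
def refBasis (H : Type*) [NormedAddCommGroup H] [InnerProductSpace ℂ H] [CompleteSpace H] :
    HilbertBasis (refIndex H) ℂ H :=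
  (exists_hilbertBasis ℂ H).choose_spec.choose

variable [CompleteSpace H]

/-- `T` is a trace-class operator: `∑ᵢ ⟨eᵢ, |T| eᵢ⟩ < ∞` where `|T| = (T* T)^{1/2}`
(whether the sum is finite does not depend on the orthonormal basis). -/
def IsTraceClass (T : H →L[ℂ] H) : Prop :=
  Summable fun i => ⟪refBasis H i, CFC.abs T (refBasis H i)⟫_ℂ

/-- The trace `∑ᵢ ⟨eᵢ, T eᵢ⟩`. It is used for trace-class operators only; for these the series
converges absolutely and its sum does not depend on the orthonormal basis. -/
def trace (T : H →L[ℂ] H) : ℂ :=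
  ∑' i, ⟪refBasis H i, T (refBasis H i)⟫_ℂ

/-- Density operators (states): positive trace-class operators of trace one. The order on bounded
operators is the Loewner order. -/
structure IsDensityOperator (W : H →L[ℂ] H) : Prop where
  nonneg : 0 ≤ W
  isTraceClass : IsTraceClass W
  trace_eq_one : trace W = 1

/-- Observables on the measurable space `M`: normalized effect-valued measures. Only the values on
measurable sets matter. Countable additivity is understood in the weak topology on bounded
operators that is given by the functionals `A ↦ tr (W A)`, `W` a density operator. -/
structure IsObservable (F : Set M → H →L[ℂ] H) : Prop where
  effect : ∀ B, MeasurableSet B → 0 ≤ F B ∧ F B ≤ 1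
  empty : F ∅ = 0
  univ : F Set.univ = 1
  iUnion : ∀ B : ℕ → Set M, (∀ n, MeasurableSet (B n)) → Pairwise (Function.onFun Disjoint B) →
    ∀ W : H →L[ℂ] H, IsDensityOperator W →
      HasSum (fun n => trace (W ∘L F (B n))) (trace (W ∘L F (⋃ n, B n)))

/-- Statistical (informational) completeness: a state `W` is determined by the probability
distribution `B ↦ tr (W F(B))` of the observable `F` in that state. -/
def IsStatisticallyComplete (F : Set M → H →L[ℂ] H) : Prop :=
  ∀ W₁ W₂ : H →L[ℂ] H, IsDensityOperator W₁ → IsDensityOperator W₂ →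
    (∀ B, MeasurableSet B → trace (W₁ ∘L F B) = trace (W₂ ∘L F B)) → W₁ = W₂

end Abstract

/-! ### Weyl operators and joint position-momentum observables on `L²(ℝᴺ)` -/

/-- `ℝᴺ` with the Euclidean inner product. -/
abbrev Space (N : ℕ) := EuclideanSpace ℝ (Fin N)

/-- The complex Hilbert space `L²(ℝᴺ)` with respect to Lebesgue measure. -/
abbrev WaveSpace (N : ℕ) := Lp ℂ 2 (volume : Measure (Space N))

variable {N : ℕ}

theorem norm_phase (p x : Space N) : ‖Complex.exp (Complex.I * (⟪p, x⟫_ℝ : ℂ))‖ = 1 := by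
  rw [mul_comm]; exact Complex.norm_exp_ofReal_mul_I _

theorem measurable_phase (p : Space N) :
    Measurable fun x : Space N => Complex.exp (Complex.I * (⟪p, x⟫_ℝ : ℂ)) := by
  fun_prop

theorem memLp_weyl (q p : Space N) (u : WaveSpace N) :
    MemLp (fun x => Complex.exp (Complex.I * (⟪p, x⟫_ℝ : ℂ)) * u (x - q)) 2 volume := by
  have h : MemLp (fun x => u (x - q)) 2 volume :=
    (Lp.memLp u).comp_measurePreserving (measurePreserving_sub_right volume q)
  refine h.of_le ((measurable_phase p).aestronglyMeasurable.mul h.1) (.of_forall fun x => ?_)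
  rw [norm_mul, norm_phase, one_mul]

/-- The unitary operator `U_{qp} = e^{ip·Q} e^{-iq·P}`, that is
`(U_{qp} u)(x) = e^{ip·x} u(x - q)`, as a linear isometry. -/
def weylIsometry (q p : Space N) : WaveSpace N →ₗᵢ[ℂ] WaveSpace N where
  toFun u := (memLp_weyl q p u).toLp _
  map_add' u v := by
    rw [← MemLp.toLp_add]
    refine MemLp.toLp_congr _ _ ?_
    filter_upwards [(measurePreserving_sub_right volume q).quasiMeasurePreserving.ae
      (Lp.coeFn_add u v)] with x hx
    simp only [hx, Pi.add_apply, mul_add]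
  map_smul' c u := by
    rw [RingHom.id_apply, ← MemLp.toLp_const_smul]
    refine MemLp.toLp_congr _ _ ?_
    filter_upwards [(measurePreserving_sub_right volume q).quasiMeasurePreserving.ae
      (Lp.coeFn_smul c u)] with x hx
    simp only [hx, Pi.smul_apply, smul_eq_mul]
    ring
  norm_map' u := by
    simp only [LinearMap.coe_mk, AddHom.coe_mk]
    rw [Lp.norm_toLp, Lp.norm_def]
    congr 1
    rw [← eLpNorm_comp_measurePreserving (Lp.aestronglyMeasurable u)
      (measurePreserving_sub_right volume q)]
    refine eLpNorm_congr_norm_ae (.of_forall fun x => ?_)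
    rw [norm_mul, norm_phase, one_mul, Function.comp_apply]

/-- `U_{qp}` as a bounded operator. -/
def weyl (q p : Space N) : WaveSpace N →L[ℂ] WaveSpace N :=
  (weylIsometry q p).toContinuousLinearMap

theorem weyl_ae_eq (q p : Space N) (u : WaveSpace N) :
    weyl q p u =ᵐ[volume] fun x => Complex.exp (Complex.I * (⟪p, x⟫_ℝ : ℂ)) * u (x - q) :=
  (memLp_weyl q p u).coeFn_toLp

/-- The phase-space translates `a_{qp} = U_{qp} a U_{qp}*` of an operator `a`; a point of phase
space `ℝᴺ × ℝᴺ = ℝ²ᴺ` is a pair `z = (q, p)`. -/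
def translate (a : WaveSpace N →L[ℂ] WaveSpace N) (z : Space N × Space N) :
    WaveSpace N →L[ℂ] WaveSpace N :=
  weyl z.1 z.2 ∘L a ∘L ContinuousLinearMap.adjoint (weyl z.1 z.2)

/-- The joint position-momentum observable generated by `a`,
`F(B) = (2π)^{-N} ∫_B a_{qp} dq dp`, as a weak integral. -/
def jointObservable (a : WaveSpace N →L[ℂ] WaveSpace N) (B : Set (Space N × Space N)) :
    WaveSpace N →L[ℂ] WaveSpace N :=
  (((2 * Real.pi) ^ N)⁻¹ : ℝ) • weakIntegral (volume.restrict B) (translate a)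

/-- The Gaussian wave function `u(x) = ∏ⱼ (2πσⱼ²)^{-1/4} exp(-xⱼ² / (4σⱼ²))`. -/
def gaussianWave (σ : Fin N → ℝ) (x : Space N) : ℝ :=
  ∏ j, (2 * Real.pi * σ j ^ 2) ^ (-(1 / 4) : ℝ) * Real.exp (-(x j) ^ 2 / (4 * σ j ^ 2))

theorem memLp_gaussianWave {σ : Fin N → ℝ} (hσ : ∀ j, 0 < σ j) :
    MemLp (fun x => (gaussianWave σ x : ℂ)) 2 (volume : Measure (Space N)) := by
  have hm : Measurable (gaussianWave σ) := by
    unfold gaussianWave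
    fun_prop
  suffices h : MemLp (gaussianWave σ) 2 (volume : Measure (Space N)) from h.ofReal
  rw [memLp_two_iff_integrable_sq hm.aestronglyMeasurable]
  have h1 : Integrable (fun y : Fin N → ℝ => ∏ j, ((2 * Real.pi * σ j ^ 2) ^ (-(1 / 4) : ℝ)) ^ 2 *
      Real.exp (-(1 / (2 * σ j ^ 2)) * (y j) ^ 2)) volume := by
    refine Integrable.fintype_prod (f := fun j (t : ℝ) =>
      ((2 * Real.pi * σ j ^ 2) ^ (-(1 / 4) : ℝ)) ^ 2 *
        Real.exp (-(1 / (2 * σ j ^ 2)) * t ^ 2)) fun j => ?_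
    have := hσ j
    exact (integrable_exp_neg_mul_sq (by positivity)).const_mul _
  have h2 := (PiLp.volume_preserving_ofLp (Fin N)).integrable_comp_of_integrable h1
  refine h2.congr (.of_forall fun x => ?_)
  simp only [Function.comp_apply, gaussianWave, ← Finset.prod_pow]
  refine Finset.prod_congr rfl fun j _ => ?_
  rw [mul_pow, ← Real.exp_nat_mul]
  have := (hσ j).ne'
  congr 2
  push_cast
  field_simp
  ring

/-- The Gaussian wave function as a vector of `L²(ℝᴺ)`. -/
def gaussianState {σ : Fin N → ℝ} (hσ : ∀ j, 0 < σ j) : WaveSpace N :=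
  (memLp_gaussianWave hσ).toLp _

/-- The operator `|u⟩⟨u|`, that is `ψ ↦ ⟨u, ψ⟩ u`. -/
def pureState (u : WaveSpace N) : WaveSpace N →L[ℂ] WaveSpace N :=
  InnerProductSpace.rankOne ℂ u u

end PhaseSpace

end

/-! Everything rests on the Moyal relations `integral_ambiguity_mul_conj`: with V(φ,f)(z) = ⟨φ, U_z
f⟩, one has ∫ V(φ₁,f₁) conj V(φ₂,f₂) dz = (2π)^N ⟨φ₁,φ₂⟩⟨f₂,f₁⟩. They are Parseval's identity in p,
because V(φ,f)(q,·) is the Fourier transform of x ↦ conj(φ(x)) f(x-q), followed by Fubini in (q,x).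

A density operator is written as Σ |fᵢ⟩⟨fᵢ| with Σ ‖fᵢ‖² = 1 (`IsEnsemble`). Then tr(WA) = Σ ⟨fᵢ, A
fᵢ⟩, and Cauchy–Schwarz for the functions V allows all sums to be integrated term by term. This
gives the weak integral, the normalization, and the density (2π)^{-N} tr(W a_z) of the outcome
distribution in the state W.

For completeness, the distribution determines tr(W a_z) for almost every z. By the Weyl relations,
multiplying V(φ,f) by a symplectic character replaces φ and f by U_ζ φ and U_ζ f. Moyal then shows
that the symplectic Fourier transform of z ↦ tr(W a_z) is (2π)^N conj(tr(W U_ζ)) tr(a U_ζ)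
(`integral_weylPhase_mul_trace`). Where tr(a U_ζ) ≠ 0 it can be divided out, so tr(W U_ζ) is known
almost everywhere, and a third use of Moyal recovers W (`integral_trace_weyl_mul_conj`). -/

noncomputable section

namespace PhaseSpace

/-! ### Plancherel and Parseval for Fourier integrals on L¹ ∩ L². -/

section Fourier

open scoped FourierTransform SchwartzMap ContDiff ComplexConjugate

variable {E : Type*} [NormedAddCommGroup E] [InnerProductSpace ℝ E] [FiniteDimensional ℝ E]
  [MeasurableSpace E] [BorelSpace E]

/-- The `L²` Fourier transform is given by the Fourier integral on `L¹ ∩ L²`. -/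
theorem fourier_toLp_ae_eq {f : E → ℂ} (h1 : Integrable f) (h2 : MemLp f 2 volume) :
    (𝓕 (h2.toLp f) : Lp ℂ 2 (volume : Measure E)) =ᵐ[volume] 𝓕 f := by
  have hcont : Continuous (𝓕 f) :=
    VectorFourier.fourierIntegral_continuous Real.continuous_fourierChar
      (by exact continuous_inner) h1
  -- Test functions in C_c^∞ are Schwartz. Against them the L² transform is defined by duality, and
  -- the Fourier integral satisfies the same duality by Fubini.
  refine ae_eq_of_integral_contDiff_smul_eq
    ((Lp.memLp _).locallyIntegrable (by norm_num)) hcont.locallyIntegrable ?_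
  intro g g_smooth g_cpt
  have hg₁ : HasCompactSupport (Complex.ofRealCLM ∘ g) := g_cpt.comp_left rfl
  have hg₂ : ContDiff ℝ ∞ (Complex.ofRealCLM ∘ g) := by fun_prop
  set G : 𝓢(E, ℂ) := hg₁.toSchwartzMap hg₂ with hG
  have hGx : ∀ x, G x = (g x : ℂ) := fun x => rfl
  have e1 := congrArg (fun T : 𝓢'(E, ℂ) => T G)
    (Lp.fourier_toTemperedDistribution_eq (h2.toLp f))
  simp only [TemperedDistribution.fourier_apply, Lp.toTemperedDistribution_apply] at e1
  have e2 : ∫ x, (𝓕 G) x • (h2.toLp f) x = ∫ x, G x • (𝓕 f) x := by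
    have e3 := VectorFourier.integral_fourierIntegral_smul_eq_flip (μ := volume) (ν := volume)
      (L := innerₗ E) Real.continuous_fourierChar (by exact continuous_inner) G.integrable h1
    rw [flip_innerₗ] at e3
    refine (integral_congr_ae ?_).trans e3
    filter_upwards [h2.coeFn_toLp] with x hx
    rw [hx, SchwartzMap.fourier_coe]
    rfl
  simpa only [hGx, Complex.real_smul, smul_eq_mul] using e1.symm.trans e2

/-- Plancherel's theorem on `L¹ ∩ L²`. -/
theorem memLp_fourier {f : E → ℂ} (h1 : Integrable f) (h2 : MemLp f 2 volume) :
    MemLp (𝓕 f) 2 volume :=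
  (memLp_congr_ae (fourier_toLp_ae_eq h1 h2)).1 (Lp.memLp _)

/-- Parseval's identity on `L¹ ∩ L²`. -/
theorem integral_fourier_mul_conj {f g : E → ℂ} (hf1 : Integrable f) (hf2 : MemLp f 2 volume)
    (hg1 : Integrable g) (hg2 : MemLp g 2 volume) :
    ∫ ξ, 𝓕 f ξ * conj (𝓕 g ξ) = ∫ x, f x * conj (g x) := by
  have h := Lp.inner_fourier_eq (hg2.toLp g) (hf2.toLp f)
  rw [L2.inner_def, L2.inner_def] at h
  calc _ = _ := integral_congr_ae ?_
    _ = _ := h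
    _ = _ := integral_congr_ae ?_
  · filter_upwards [fourier_toLp_ae_eq hf1 hf2, fourier_toLp_ae_eq hg1 hg2] with x hx hy
    rw [hx, hy, RCLike.inner_apply]
  · filter_upwards [hf2.coeFn_toLp, hg2.coeFn_toLp] with x hx hy
    rw [hx, hy, RCLike.inner_apply]

/-- The Fourier transform in the normalization `∫ exp(i⟨p, x⟩) f(x) dx`. -/
def expIntegral (f : E → ℂ) (p : E) : ℂ :=
  ∫ x, Complex.exp (Complex.I * (⟪p, x⟫_ℝ : ℂ)) * f x

theorem expIntegral_eq (f : E → ℂ) (p : E) :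
    expIntegral f p = 𝓕 f ((-(2 * Real.pi)⁻¹ : ℝ) • p) := by
  rw [Real.fourier_eq', expIntegral]
  congr 1 with x
  rw [smul_eq_mul, real_inner_smul_right, real_inner_comm]
  congr 2
  have : (Real.pi : ℂ) ≠ 0 := by exact_mod_cast Real.pi_ne_zero
  push_cast
  field_simp

theorem memLp_expIntegral {f : E → ℂ} (h1 : Integrable f) (h2 : MemLp f 2 volume) :
    MemLp (expIntegral f) 2 volume := by
  have hcont : Continuous (𝓕 f) :=
    VectorFourier.fourierIntegral_continuous Real.continuous_fourierChar
      (by exact continuous_inner) h1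
  have hF := memLp_fourier h1 h2
  rw [memLp_two_iff_integrable_sq_norm hF.1] at hF
  have h0 : (-(2 * Real.pi)⁻¹ : ℝ) ≠ 0 := by
    have := Real.pi_pos
    exact neg_ne_zero.2 (by positivity)
  have e : expIntegral f = fun p => 𝓕 f ((-(2 * Real.pi)⁻¹ : ℝ) • p) :=
    funext fun p => expIntegral_eq f p
  rw [memLp_two_iff_integrable_sq_norm
    (by rw [e]; exact (hcont.comp (by fun_prop)).aestronglyMeasurable), e]
  exact (integrable_comp_smul_iff volume (fun ξ => ‖𝓕 f ξ‖ ^ 2) h0).2 hF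

/-- The dilation by -(2π)⁻¹ relating `expIntegral` to `𝓕` has Jacobian factor (2π)^n; this is the
source of the (2π)^N in the observable. -/
theorem integral_expIntegral_mul_conj {f g : E → ℂ} (hf1 : Integrable f)
    (hf2 : MemLp f 2 volume) (hg1 : Integrable g) (hg2 : MemLp g 2 volume) :
    ∫ p, expIntegral f p * conj (expIntegral g p) =
      ((2 * Real.pi) ^ Module.finrank ℝ E : ℝ) * ∫ x, f x * conj (g x) := by
  simp_rw [expIntegral_eq]
  rw [Measure.integral_comp_smul volume (fun ξ => 𝓕 f ξ * conj (𝓕 g ξ)),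
    integral_fourier_mul_conj hf1 hf2 hg1 hg2, Complex.real_smul]
  congr 2
  have := Real.pi_pos
  rw [abs_inv, abs_pow, abs_neg, abs_inv, abs_of_pos (by positivity), inv_pow, inv_inv]

end Fourier

/-! ### Square integrability and orthogonality of the Weyl matrix elements. -/

section Moyal

open scoped ComplexConjugate

variable {N : ℕ}

/-- The function `x ↦ conj (φ x) f(x - q)`, whose Fourier transform is `p ↦ ⟨φ, U_{qp} f⟩`. -/
def translateProd (φ f : WaveSpace N) (z : Space N × Space N) : ℂ :=
  conj (φ z.2) * f (z.2 - z.1)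

theorem stronglyMeasurable_translateProd (φ f : WaveSpace N) :
    StronglyMeasurable (translateProd φ f) := by
  refine StronglyMeasurable.mul ?_ ?_
  · exact Complex.continuous_conj.comp_stronglyMeasurable
      ((Lp.stronglyMeasurable φ).comp_measurable measurable_snd)
  · exact (Lp.stronglyMeasurable f).comp_measurable (measurable_snd.sub measurable_fst)

theorem integrable_norm_sq (f : WaveSpace N) : Integrable (fun x => ‖f x‖ ^ 2) volume :=
  (memLp_two_iff_integrable_sq_norm (Lp.memLp f).1).1 (Lp.memLp f)

/-- Integrating over q first, at fixed x, leaves |φ(x)|² ‖f‖², which is integrable in x. -/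
theorem memLp_translateProd (φ f : WaveSpace N) : MemLp (translateProd φ f) 2 volume := by
  have hm := stronglyMeasurable_translateProd φ f
  have hm2 : AEStronglyMeasurable (fun z => ‖translateProd φ f z‖ ^ 2)
      ((volume : Measure (Space N)).prod (volume : Measure (Space N))) :=
    (hm.norm.pow 2).aestronglyMeasurable
  rw [memLp_two_iff_integrable_sq_norm hm.aestronglyMeasurable, Measure.volume_eq_prod,
    integrable_prod_iff' hm2]
  simp only [translateProd, norm_mul, mul_pow, RCLike.norm_conj, norm_pow, norm_norm]
  refine ⟨.of_forall fun x => ((integrable_norm_sq f).comp_sub_left x).const_mul _, ?_⟩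
  simp_rw [integral_const_mul, integral_sub_left_eq_self (fun y => ‖f y‖ ^ 2)]
  exact (integrable_norm_sq φ).mul_const _

theorem integrable_translateProd (φ f : WaveSpace N) (q : Space N) :
    Integrable (fun x => translateProd φ f (q, x)) volume := by
  have h : MemLp (fun x => f (x - q)) 2 volume :=
    (Lp.memLp f).comp_measurePreserving (measurePreserving_sub_right volume q)
  exact (Lp.memLp φ).star.integrable_mul h

/-- A product of two L² functions is L¹ for every q, but square integrability of the fibre comes
from Fubini and so holds only for almost every q. -/
theorem ae_memLp_translateProd (φ f : WaveSpace N) :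
    ∀ᵐ q, MemLp (fun x => translateProd φ f (q, x)) 2 volume := by
  have h := memLp_translateProd φ f
  rw [memLp_two_iff_integrable_sq_norm h.1, Measure.volume_eq_prod] at h
  filter_upwards [h.prod_right_ae] with q hq
  rw [memLp_two_iff_integrable_sq_norm (integrable_translateProd φ f q).1]
  exact hq

/-- The matrix elements `⟨φ, U_{qp} f⟩` as a function on phase space. -/
def ambiguity (φ f : WaveSpace N) (z : Space N × Space N) : ℂ :=
  ⟪φ, weyl z.1 z.2 f⟫_ℂ

theorem ambiguity_eq (φ f : WaveSpace N) (z : Space N × Space N) :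
    ambiguity φ f z = expIntegral (fun x => translateProd φ f (z.1, x)) z.2 := by
  rw [ambiguity, L2.inner_def, expIntegral]
  refine integral_congr_ae ?_
  filter_upwards [weyl_ae_eq z.1 z.2 f] with x hx
  rw [hx, RCLike.inner_apply, translateProd]
  ring

theorem stronglyMeasurable_ambiguity (φ f : WaveSpace N) :
    StronglyMeasurable (ambiguity φ f) := by
  have e : ambiguity φ f = fun z => ∫ x, Complex.exp (Complex.I * (⟪z.2, x⟫_ℝ : ℂ)) *
      translateProd φ f (z.1, x) := funext fun z => ambiguity_eq φ f z
  rw [e]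
  refine StronglyMeasurable.integral_prod_right'
    (f := fun y : (Space N × Space N) × Space N => Complex.exp (Complex.I * (⟪y.1.2, y.2⟫_ℝ : ℂ)) *
      translateProd φ f (y.1.1, y.2)) ?_
  refine StronglyMeasurable.mul ?_ ?_
  · exact Continuous.stronglyMeasurable (by fun_prop)
  · exact (stronglyMeasurable_translateProd φ f).comp_measurable (by fun_prop)

theorem integral_ambiguity_mul_conj_right (φ₁ f₁ φ₂ f₂ : WaveSpace N) :
    ∀ᵐ q, ∫ p, ambiguity φ₁ f₁ (q, p) * conj (ambiguity φ₂ f₂ (q, p)) =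
      ((2 * Real.pi) ^ N : ℝ) *
        ∫ x, translateProd φ₁ f₁ (q, x) * conj (translateProd φ₂ f₂ (q, x)) := by
  filter_upwards [ae_memLp_translateProd φ₁ f₁, ae_memLp_translateProd φ₂ f₂] with q h1 h2
  simp only [ambiguity_eq]
  rw [integral_expIntegral_mul_conj (integrable_translateProd φ₁ f₁ q) h1
    (integrable_translateProd φ₂ f₂ q) h2, finrank_euclideanSpace, Fintype.card_fin]

theorem memLp_ambiguity (φ f : WaveSpace N) : MemLp (ambiguity φ f) 2 volume := by
  have hm := stronglyMeasurable_ambiguity φ f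
  have hm2 : AEStronglyMeasurable (fun z => ‖ambiguity φ f z‖ ^ 2)
      ((volume : Measure (Space N)).prod (volume : Measure (Space N))) :=
    (hm.norm.pow 2).aestronglyMeasurable
  rw [memLp_two_iff_integrable_sq_norm hm.aestronglyMeasurable, Measure.volume_eq_prod,
    integrable_prod_iff hm2]
  constructor
  · filter_upwards [ae_memLp_translateProd φ f] with q hq
    have h := memLp_expIntegral (integrable_translateProd φ f q) hq
    rw [memLp_two_iff_integrable_sq_norm h.1] at h
    simpa only [ambiguity_eq] using h
  · have h := memLp_translateProd φ f
    rw [memLp_two_iff_integrable_sq_norm h.1, Measure.volume_eq_prod] at h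
    refine (h.integral_prod_left.const_mul ((2 * Real.pi) ^ N)).congr ?_
    filter_upwards [integral_ambiguity_mul_conj_right φ f φ f] with q hq
    simp only [Complex.mul_conj, Complex.normSq_eq_norm_sq] at hq
    rw [integral_complex_ofReal, integral_complex_ofReal] at hq
    simp only [norm_pow, norm_norm]
    exact_mod_cast hq.symm

/-- The orthogonality (Moyal) relations for the Weyl operators. -/
theorem integral_ambiguity_mul_conj (φ₁ f₁ φ₂ f₂ : WaveSpace N) :
    ∫ z, ambiguity φ₁ f₁ z * conj (ambiguity φ₂ f₂ z) =
      ((2 * Real.pi) ^ N : ℝ) * (⟪φ₁, φ₂⟫_ℂ * ⟪f₂, f₁⟫_ℂ) := by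
  have hV : Integrable (fun z => ambiguity φ₁ f₁ z * conj (ambiguity φ₂ f₂ z)) :=
    (memLp_ambiguity φ₁ f₁).integrable_mul (memLp_ambiguity φ₂ f₂).star
  have hG : Integrable (fun z => translateProd φ₁ f₁ z * conj (translateProd φ₂ f₂ z)) :=
    (memLp_translateProd φ₁ f₁).integrable_mul (memLp_translateProd φ₂ f₂).star
  rw [Measure.volume_eq_prod] at hV hG ⊢
  -- The p-integral is done first, at fixed q, by Parseval. In the remaining (q,x) integral the
  -- order is swapped, so that translation invariance in q separates the two inner products.
  rw [integral_prod _ hV, integral_congr_ae (integral_ambiguity_mul_conj_right φ₁ f₁ φ₂ f₂),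
    integral_const_mul, ← integral_prod _ hG, integral_prod_symm _ hG]
  congr 1
  have e : ∀ x q : Space N, translateProd φ₁ f₁ (q, x) * conj (translateProd φ₂ f₂ (q, x)) =
      ⟪φ₁ x, φ₂ x⟫_ℂ * ⟪f₂ (x - q), f₁ (x - q)⟫_ℂ := fun x q => by
    simp only [translateProd, RCLike.inner_apply, map_mul, Complex.conj_conj]
    ring
  simp_rw [e, integral_const_mul, integral_sub_left_eq_self (fun y => ⟪f₂ y, f₁ y⟫_ℂ)]
  rw [integral_mul_const, ← L2.inner_def, ← L2.inner_def]

theorem integral_norm_sq_ambiguity (φ f : WaveSpace N) :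
    ∫ z, ‖ambiguity φ f z‖ ^ 2 = (2 * Real.pi) ^ N * (‖φ‖ ^ 2 * ‖f‖ ^ 2) := by
  have h := integral_ambiguity_mul_conj φ f φ f
  simp only [Complex.mul_conj, Complex.normSq_eq_norm_sq] at h
  rw [integral_complex_ofReal, inner_self_eq_norm_sq_to_K, inner_self_eq_norm_sq_to_K] at h
  rw [← Complex.ofReal_inj, h]
  push_cast
  rfl

/-- Cauchy–Schwarz in L² of phase space; this bound dominates the ensemble sums in every termwise
integration below. -/
theorem integral_norm_ambiguity_mul_le (φ₁ f₁ φ₂ f₂ : WaveSpace N) :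
    ∫ z, ‖ambiguity φ₁ f₁ z‖ * ‖ambiguity φ₂ f₂ z‖ ≤
      (2 * Real.pi) ^ N * (‖φ₁‖ * ‖f₁‖ * (‖φ₂‖ * ‖f₂‖)) := by
  have h := integral_mul_le_Lp_mul_Lq_of_nonneg (μ := (volume : Measure (Space N × Space N)))
    (p := 2) (q := 2) Real.HolderConjugate.two_two
    (f := fun z => ‖ambiguity φ₁ f₁ z‖) (g := fun z => ‖ambiguity φ₂ f₂ z‖)
    (.of_forall fun _ => norm_nonneg _) (.of_forall fun _ => norm_nonneg _)
    (by simpa using (memLp_ambiguity φ₁ f₁).norm) (by simpa using (memLp_ambiguity φ₂ f₂).norm)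
  simp only [Real.rpow_two, integral_norm_sq_ambiguity, ← Real.sqrt_eq_rpow] at h
  refine h.trans (le_of_eq ?_)
  have := Real.pi_pos
  rw [← Real.sqrt_mul (by positivity), Real.sqrt_eq_iff_mul_self_eq (by positivity) (by positivity)]
  ring

end Moyal

/-! ### Density operators as sums of rank-one operators, and the trace formula. -/

section Ensemble

variable {H : Type*} [NormedAddCommGroup H] [InnerProductSpace ℂ H]

/-- `W = ∑ᵢ |fᵢ⟩⟨fᵢ|` with `∑ᵢ ‖fᵢ‖² = 1`. -/
structure IsEnsemble {ι : Type*} (W : H →L[ℂ] H) (f : ι → H) : Prop where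
  hasSum_norm_sq : HasSum (fun i => ‖f i‖ ^ 2) 1
  hasSum_inner : ∀ φ ψ, HasSum (fun i => ⟪φ, f i⟫_ℂ * ⟪f i, ψ⟫_ℂ) ⟪φ, W ψ⟫_ℂ

theorem IsEnsemble.subtype_support {ι : Type*} {W : H →L[ℂ] H} {f : ι → H}
    (h : IsEnsemble W f) : IsEnsemble W (fun i : Function.support f => f i) where
  hasSum_norm_sq := (hasSum_subtype_iff_of_support_subset (f := fun i => ‖f i‖ ^ 2)
    (fun i hi => by contrapose! hi; simp_all)).2 h.hasSum_norm_sq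
  hasSum_inner φ ψ := (hasSum_subtype_iff_of_support_subset
    (f := fun i => ⟪φ, f i⟫_ℂ * ⟪f i, ψ⟫_ℂ)
    (fun i hi => by contrapose! hi; simp_all)).2 (h.hasSum_inner φ ψ)

theorem IsEnsemble.countable_support {ι : Type*} {W : H →L[ℂ] H} {f : ι → H}
    (h : IsEnsemble W f) : Countable (Function.support f) :=
  (h.hasSum_norm_sq.summable.countable_support.mono fun i hi => by
    simpa using hi).to_subtype

theorem hasSum_norm_sq_inner_basis {κ : Type*} (b : HilbertBasis κ ℂ H) (x : H) :
    HasSum (fun j => ‖⟪b j, x⟫_ℂ‖ ^ 2) (‖x‖ ^ 2) := by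
  have h := b.hasSum_inner_mul_inner x x
  rw [inner_self_eq_norm_sq_to_K] at h
  have e : ∀ j, ⟪x, b j⟫_ℂ * ⟪b j, x⟫_ℂ = ((‖⟪b j, x⟫_ℂ‖ ^ 2 : ℝ) : ℂ) := fun j => by
    rw [← inner_conj_symm x, RCLike.conj_mul]
    push_cast
    rfl
  simp only [e] at h
  refine Complex.hasSum_ofReal.1 ?_
  rw [Complex.ofReal_pow]
  exact h

theorem isEnsemble_rankOne {u : H} (hu : ‖u‖ = 1) :
    IsEnsemble (InnerProductSpace.rankOne ℂ u u) (fun _ : Unit => u) where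
  hasSum_norm_sq := by simp [hu]
  hasSum_inner φ ψ := by
    rw [InnerProductSpace.rankOne_apply, inner_smul_right, mul_comm ⟪u, ψ⟫_ℂ]
    exact hasSum_unique (fun _ : Unit => ⟪φ, u⟫_ℂ * ⟪u, ψ⟫_ℂ) _

/-- A Hilbert–Schmidt bound: summing over the basis gives ‖B fᵢ‖² ≤ ‖B‖² ‖fᵢ‖². -/
theorem IsEnsemble.summable_norm_sq_inner {ι κ : Type*} {W : H →L[ℂ] H} {f : ι → H}
    (h : IsEnsemble W f) (b : HilbertBasis κ ℂ H) (B : H →L[ℂ] H) :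
    Summable fun x : ι × κ => ‖⟪b x.2, B (f x.1)⟫_ℂ‖ ^ 2 := by
  have h0 : 0 ≤ fun x : ι × κ => ‖⟪b x.2, B (f x.1)⟫_ℂ‖ ^ 2 := fun x => by positivity
  have hi : ∀ i, HasSum (fun j => ‖⟪b j, B (f i)⟫_ℂ‖ ^ 2) (‖B (f i)‖ ^ 2) := fun i =>
    hasSum_norm_sq_inner_basis b _
  rw [summable_prod_of_nonneg h0]
  refine ⟨fun i => (hi i).summable, ?_⟩
  simp only [(hi _).tsum_eq]
  refine Summable.of_nonneg_of_le (fun _ => sq_nonneg _) (fun i => ?_)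
    (h.hasSum_norm_sq.summable.mul_left (‖B‖ ^ 2))
  rw [← mul_pow]
  exact pow_le_pow_left₀ (norm_nonneg _) (B.le_opNorm _) 2

variable [CompleteSpace H]

/-- The double series Σ ⟨A* fᵢ, bⱼ⟩⟨bⱼ, fᵢ⟩ converges absolutely. Summed over j first it gives the
ensemble expression, summed over i first the trace in the basis b. -/
theorem IsEnsemble.hasSum_trace_hilbertBasis {ι κ : Type*} {W : H →L[ℂ] H} {f : ι → H}
    (h : IsEnsemble W f) (b : HilbertBasis κ ℂ H) (A : H →L[ℂ] H) :
    HasSum (fun i => ⟪f i, A (f i)⟫_ℂ) (∑' j, ⟪b j, (W ∘L A) (b j)⟫_ℂ) := by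
  let c : ι × κ → ℂ := fun x =>
    ⟪ContinuousLinearMap.adjoint A (f x.1), b x.2⟫_ℂ * ⟪b x.2, f x.1⟫_ℂ
  have hc : Summable c := by
    refine Summable.of_norm_bounded
      ((h.summable_norm_sq_inner b (ContinuousLinearMap.adjoint A)).add
        (h.summable_norm_sq_inner b (ContinuousLinearMap.id ℂ H))) fun x => ?_
    simp only [c, norm_mul, norm_inner_symm (ContinuousLinearMap.adjoint A _),
      ContinuousLinearMap.id_apply]
    nlinarith [two_mul_le_add_sq ‖⟪b x.2, ContinuousLinearMap.adjoint A (f x.1)⟫_ℂ‖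
      ‖⟪b x.2, f x.1⟫_ℂ‖, mul_nonneg
      (norm_nonneg ⟪b x.2, ContinuousLinearMap.adjoint A (f x.1)⟫_ℂ)
      (norm_nonneg ⟪b x.2, f x.1⟫_ℂ)]
  have h1 : HasSum (fun i => ⟪f i, A (f i)⟫_ℂ) (∑' x, c x) := by
    refine hc.hasSum.prod_fiberwise fun i => ?_
    have := b.hasSum_inner_mul_inner (ContinuousLinearMap.adjoint A (f i)) (f i)
    rwa [ContinuousLinearMap.adjoint_inner_left] at this
  have h2 : HasSum (fun j => ⟪b j, (W ∘L A) (b j)⟫_ℂ) (∑' x, c x) := by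
    refine ((Equiv.prodComm κ ι).hasSum_iff.2 hc.hasSum).prod_fiberwise fun j => ?_
    convert h.hasSum_inner (b j) (A (b j)) using 2 with i
    · change ⟪ContinuousLinearMap.adjoint A (f i), b j⟫_ℂ * ⟪b j, f i⟫_ℂ = _
      rw [ContinuousLinearMap.adjoint_inner_left, mul_comm]
    · rfl
  rwa [h2.tsum_eq]

/-- The trace formula `tr (W A) = ∑ᵢ ⟨fᵢ, A fᵢ⟩` for `W = ∑ᵢ |fᵢ⟩⟨fᵢ|`. -/
theorem IsEnsemble.hasSum_trace {ι : Type*} {W : H →L[ℂ] H} {f : ι → H}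
    (h : IsEnsemble W f) (A : H →L[ℂ] H) :
    HasSum (fun i => ⟪f i, A (f i)⟫_ℂ) (trace (W ∘L A)) :=
  h.hasSum_trace_hilbertBasis (refBasis H) A

/-- With S = √W, Parseval for ⟨Sφ, Sψ⟩ = ⟨φ, Wψ⟩ yields the decomposition into the vectors S eᵢ; no
spectral theorem for compact operators is needed. -/
theorem IsDensityOperator.isEnsemble_sqrt {W : H →L[ℂ] H} (hW : IsDensityOperator W) :
    IsEnsemble W (fun i => CFC.sqrt W (refBasis H i)) := by
  set S := CFC.sqrt W
  set b := refBasis H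
  have hS : IsSelfAdjoint S := (CFC.sqrt_nonneg W).isSelfAdjoint
  have hSS : S * S = W := CFC.sqrt_mul_sqrt_self W hW.nonneg
  have hsym : ∀ x y, ⟪S x, y⟫_ℂ = ⟪x, S y⟫_ℂ := fun x y => by
    rw [← ContinuousLinearMap.adjoint_inner_right, ← ContinuousLinearMap.star_eq_adjoint, hS.star_eq]
  have hW' : ∀ x y, ⟪S x, S y⟫_ℂ = ⟪x, W y⟫_ℂ := fun x y => by rw [hsym, ← hSS]; rfl
  constructor
  · have h1 : HasSum (fun i => ⟪b i, W (b i)⟫_ℂ) 1 := by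
      have h := hW.isTraceClass
      rw [IsTraceClass, CFC.abs_of_nonneg W hW.nonneg] at h
      rw [← hW.trace_eq_one]
      exact h.hasSum
    simp only [← hW', inner_self_eq_norm_sq_to_K] at h1
    exact Complex.hasSum_ofReal.1 (by push_cast; exact h1)
  · intro φ ψ
    have h1 := b.hasSum_inner_mul_inner (S φ) (S ψ)
    rw [hW'] at h1
    simpa only [hsym φ, ← hsym _ ψ] using h1

/-- Discarding the zero vectors makes the index set countable, as termwise integration requires. -/
theorem IsDensityOperator.exists_isEnsemble {W : H →L[ℂ] H} (hW : IsDensityOperator W) :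
    ∃ (s : Set (refIndex H)) (f : s → H), Countable s ∧ IsEnsemble W f :=
  ⟨_, _, hW.isEnsemble_sqrt.countable_support, hW.isEnsemble_sqrt.subtype_support⟩

theorem isDensityOperator_rankOne {u : H} (hu : ‖u‖ = 1) :
    IsDensityOperator (InnerProductSpace.rankOne ℂ u u) := by
  have e : ∀ i, ⟪refBasis H i, InnerProductSpace.rankOne ℂ u u (refBasis H i)⟫_ℂ =
      ⟪u, refBasis H i⟫_ℂ * ⟪refBasis H i, u⟫_ℂ := fun i => by
    rw [InnerProductSpace.rankOne_apply, inner_smul_right]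
  have h0 : 0 ≤ InnerProductSpace.rankOne ℂ u u := by
    rw [ContinuousLinearMap.nonneg_iff_isPositive]
    exact InnerProductSpace.isPositive_rankOne_self u
  have hs := (refBasis H).hasSum_inner_mul_inner u u
  refine ⟨h0, ?_, ?_⟩
  · rw [IsTraceClass, CFC.abs_of_nonneg _ h0]
    simpa only [e] using hs.summable
  · simp only [trace, e]
    rw [hs.tsum_eq, inner_self_eq_norm_sq_to_K, hu]
    simp

end Ensemble

/-! ### Termwise integration of series. -/

section SumIntegral

/-- Termwise integration of a pointwise convergent series with absolutely summable integrals. -/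
theorem integral_hasSum_of_summable_integral_norm {α ι E : Type*} [MeasurableSpace α]
    {μ : Measure α} [Countable ι] [NormedAddCommGroup E] [NormedSpace ℝ E] [CompleteSpace E]
    {F : ι → α → E} {G : α → E}
    (hF : ∀ i, Integrable (F i) μ) (hs : Summable fun i => ∫ x, ‖F i x‖ ∂μ)
    (hG : ∀ x, HasSum (fun i => F i x) (G x)) :
    Integrable G μ ∧ HasSum (fun i => ∫ x, F i x ∂μ) (∫ x, G x ∂μ) ∧
      ∫ x, ‖G x‖ ∂μ ≤ ∑' i, ∫ x, ‖F i x‖ ∂μ := by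
  have hGF : G = fun x => ∑' i, F i x := funext fun x => (hG x).tsum_eq.symm
  have hle : ∫⁻ x, ‖G x‖ₑ ∂μ ≤ ENNReal.ofReal (∑' i, ∫ x, ‖F i x‖ ∂μ) := by
    calc ∫⁻ x, ‖G x‖ₑ ∂μ ≤ ∫⁻ x, ∑' i, ‖F i x‖ₑ ∂μ := by
          refine lintegral_mono fun x => ?_
          rw [hGF]
          exact enorm_tsum_le_tsum_enorm
      _ = ∑' i, ∫⁻ x, ‖F i x‖ₑ ∂μ := lintegral_tsum fun i => (hF i).1.enorm
      _ = ENNReal.ofReal (∑' i, ∫ x, ‖F i x‖ ∂μ) := by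
          rw [ENNReal.ofReal_tsum_of_nonneg (fun i => integral_nonneg fun _ => norm_nonneg _) hs]
          exact tsum_congr fun i => (ofReal_integral_norm_eq_lintegral_enorm (hF i)).symm
  have hm : AEStronglyMeasurable G μ :=
    -- Countability of `ι` makes the filter of finite subsets countably generated, so the limit of
    -- the partial sums is measurable.
    aestronglyMeasurable_of_tendsto_ae Filter.atTop
      (f := fun (s : Finset ι) x => ∑ i ∈ s, F i x)
      (fun s => Finset.aestronglyMeasurable_fun_sum s fun i _ => (hF i).1)
      (.of_forall fun x => by simpa [HasSum] using hG x)
  refine ⟨⟨hm, hle.trans_lt ENNReal.ofReal_lt_top⟩, ?_, ?_⟩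
  · rw [hGF]
    exact hasSum_integral_of_summable_integral_norm hF hs
  · rw [integral_norm_eq_lintegral_enorm hm]
    exact ENNReal.toReal_le_of_le_ofReal
      (tsum_nonneg fun i => integral_nonneg fun _ => norm_nonneg _) hle

end SumIntegral

/-! ### Existence of the weak integral and the observable axioms. -/

section Observable

open scoped ComplexConjugate

variable {N : ℕ} {a W : WaveSpace N →L[ℂ] WaveSpace N}

theorem IsEnsemble.hasSum_inner_translate {ι : Type*} {f : ι → WaveSpace N}
    (h : IsEnsemble a f) (φ ψ : WaveSpace N) (z : Space N × Space N) :
    HasSum (fun i => ambiguity φ (f i) z * conj (ambiguity ψ (f i) z)) ⟪φ, translate a z ψ⟫_ℂ := by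
  have h1 := h.hasSum_inner (ContinuousLinearMap.adjoint (weyl z.1 z.2) φ)
    (ContinuousLinearMap.adjoint (weyl z.1 z.2) ψ)
  simp only [ContinuousLinearMap.adjoint_inner_left, ContinuousLinearMap.adjoint_inner_right] at h1
  simp only [ambiguity, inner_conj_symm]
  exact h1

theorem IsEnsemble.summable_integral_norm_ambiguity {ι : Type*} {f : ι → WaveSpace N}
    (h : IsEnsemble a f) (φ ψ : WaveSpace N) :
    (Summable fun i => ∫ z, ‖ambiguity φ (f i) z‖ * ‖ambiguity ψ (f i) z‖) ∧
      ∑' i, ∫ z, ‖ambiguity φ (f i) z‖ * ‖ambiguity ψ (f i) z‖ ≤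
        (2 * Real.pi) ^ N * (‖φ‖ * ‖ψ‖) := by
  have hle : ∀ i, ∫ z, ‖ambiguity φ (f i) z‖ * ‖ambiguity ψ (f i) z‖ ≤
      (2 * Real.pi) ^ N * (‖φ‖ * ‖ψ‖) * ‖f i‖ ^ 2 := fun i =>
    (integral_norm_ambiguity_mul_le φ (f i) ψ (f i)).trans_eq (by ring)
  have hs := h.hasSum_norm_sq.mul_left ((2 * Real.pi) ^ N * (‖φ‖ * ‖ψ‖))
  have hsum := Summable.of_nonneg_of_le
    (fun i => integral_nonneg fun z => mul_nonneg (norm_nonneg _) (norm_nonneg _)) hle hs.summable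
  exact ⟨hsum, (hsum.tsum_le_tsum hle hs.summable).trans_eq (by rw [hs.tsum_eq, mul_one])⟩

theorem integrable_ambiguity_mul_conj (φ₁ f₁ φ₂ f₂ : WaveSpace N) :
    Integrable (fun z => ambiguity φ₁ f₁ z * conj (ambiguity φ₂ f₂ z)) :=
  (memLp_ambiguity φ₁ f₁).integrable_mul (memLp_ambiguity φ₂ f₂).star

/-- Absolute integrability of `z ↦ ⟨φ, a_z ψ⟩`, with the value and a bound of the integral. -/
theorem integral_inner_translate (ha : IsDensityOperator a) (φ ψ : WaveSpace N) :
    Integrable (fun z => ⟪φ, translate a z ψ⟫_ℂ) ∧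
      ∫ z, ⟪φ, translate a z ψ⟫_ℂ = ((2 * Real.pi) ^ N : ℝ) * ⟪φ, ψ⟫_ℂ ∧
      ∫ z, ‖⟪φ, translate a z ψ⟫_ℂ‖ ≤ (2 * Real.pi) ^ N * (‖φ‖ * ‖ψ‖) := by
  obtain ⟨s, f, hc, hf⟩ := ha.exists_isEnsemble
  obtain ⟨h1, h2⟩ := hf.summable_integral_norm_ambiguity φ ψ
  obtain ⟨h3, h4, h5⟩ := integral_hasSum_of_summable_integral_norm
    (F := fun i z => ambiguity φ (f i) z * conj (ambiguity ψ (f i) z))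
    (fun i => integrable_ambiguity_mul_conj φ (f i) ψ (f i))
    (by simpa only [norm_mul, RCLike.norm_conj] using h1) (hf.hasSum_inner_translate φ ψ)
  refine ⟨h3, h4.unique ?_, h5.trans ?_⟩
  -- By Moyal the i-th term integrates to (2π)^N ⟨φ,ψ⟩ ‖fᵢ‖², and Σ ‖fᵢ‖² = 1.
  · have h6 := ((Complex.hasSum_ofReal.2 hf.hasSum_norm_sq).mul_left ⟪φ, ψ⟫_ℂ).mul_left
      (((2 * Real.pi) ^ N : ℝ) : ℂ)
    rw [Complex.ofReal_one, mul_one] at h6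
    have h7 : (fun i => ∫ z, ambiguity φ (f i) z * conj (ambiguity ψ (f i) z)) =
        fun i => (((2 * Real.pi) ^ N : ℝ) : ℂ) * (⟪φ, ψ⟫_ℂ * ((‖f i‖ ^ 2 : ℝ) : ℂ)) :=
      funext fun i => by
        rw [integral_ambiguity_mul_conj, inner_self_eq_norm_sq_to_K, Complex.ofReal_pow ‖f i‖]
        rfl
    rw [h7]
    exact h6
  · simpa only [norm_mul, RCLike.norm_conj] using h2

/-- The integrated matrix elements form a sesquilinear form bounded by (2π)^N ‖φ‖ ‖ψ‖, so Riesz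
representation supplies the operator. -/
theorem exists_hasWeakIntegral_translate (ha : IsDensityOperator a)
    (B : Set (Space N × Space N)) :
    ∃ A, HasWeakIntegral (volume.restrict B) (translate a) A := by
  have hi : ∀ φ ψ, Integrable (fun z => ⟪φ, translate a z ψ⟫_ℂ) (volume.restrict B) :=
    fun φ ψ => (integral_inner_translate ha φ ψ).1.restrict
  let b : WaveSpace N →ₗ⋆[ℂ] WaveSpace N →ₗ[ℂ] ℂ :=
    LinearMap.mk₂'ₛₗ (starRingEnd ℂ) (RingHom.id ℂ)
      (fun φ ψ => ∫ z in B, ⟪φ, translate a z ψ⟫_ℂ)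
      (fun φ₁ φ₂ ψ => by
        simp only [inner_add_left]
        exact integral_add (hi _ _) (hi _ _))
      (fun c φ ψ => by
        simp only [inner_smul_left, smul_eq_mul]
        exact integral_const_mul _ _)
      (fun φ ψ₁ ψ₂ => by
        simp only [map_add, inner_add_right]
        exact integral_add (hi _ _) (hi _ _))
      (fun c φ ψ => by
        simp only [map_smul, inner_smul_right, smul_eq_mul, RingHom.id_apply]
        exact integral_const_mul _ _)
  have hb : ∀ φ ψ, ‖b φ ψ‖ ≤ (2 * Real.pi) ^ N * ‖φ‖ * ‖ψ‖ := fun φ ψ =>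
    calc ‖∫ z in B, ⟪φ, translate a z ψ⟫_ℂ‖ ≤ ∫ z in B, ‖⟪φ, translate a z ψ⟫_ℂ‖ :=
          norm_integral_le_integral_norm _
      _ ≤ ∫ z, ‖⟪φ, translate a z ψ⟫_ℂ‖ :=
          setIntegral_le_integral (integral_inner_translate ha φ ψ).1.norm
            (.of_forall fun _ => norm_nonneg _)
      _ ≤ (2 * Real.pi) ^ N * ‖φ‖ * ‖ψ‖ :=
          (integral_inner_translate ha φ ψ).2.2.trans_eq (by ring)
  -- The operator representing the form acts in the left slot of the inner product; the adjoint
  -- moves it to the right.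
  refine ⟨ContinuousLinearMap.adjoint
    (InnerProductSpace.continuousLinearMapOfBilin (b.mkContinuous₂ _ hb)), fun φ ψ => ⟨hi φ ψ, ?_⟩⟩
  rw [ContinuousLinearMap.adjoint_inner_right,
    InnerProductSpace.continuousLinearMapOfBilin_apply]
  rfl

theorem inner_jointObservable (ha : IsDensityOperator a) (B : Set (Space N × Space N))
    (φ ψ : WaveSpace N) :
    ⟪φ, jointObservable a B ψ⟫_ℂ =
      (((2 * Real.pi) ^ N)⁻¹ : ℝ) * ∫ z in B, ⟪φ, translate a z ψ⟫_ℂ := by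
  obtain ⟨A, hA⟩ := exists_hasWeakIntegral_translate ha B
  rw [jointObservable, hA.weakIntegral_eq, smul_apply, ← (hA φ ψ).2,
    inner_smul_right_eq_smul, Complex.real_smul]

theorem jointObservable_univ (ha : IsDensityOperator a) :
    jointObservable a Set.univ = 1 := by
  ext1 ψ
  refine ext_inner_left ℂ fun φ => ?_
  have := Real.pi_pos
  rw [inner_jointObservable ha, Measure.restrict_univ, (integral_inner_translate ha φ ψ).2.1,
    ← mul_assoc, ← Complex.ofReal_mul, inv_mul_cancel₀ (by positivity), Complex.ofReal_one, one_mul]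
  rfl

theorem jointObservable_empty (ha : IsDensityOperator a) : jointObservable a ∅ = 0 := by
  ext1 ψ
  refine ext_inner_left ℂ fun φ => ?_
  rw [inner_jointObservable ha, Measure.restrict_empty, integral_zero_measure, mul_zero]
  simp

theorem jointObservable_add_compl (ha : IsDensityOperator a) {B : Set (Space N × Space N)}
    (hB : MeasurableSet B) : jointObservable a B + jointObservable a Bᶜ = 1 := by
  rw [← jointObservable_univ ha]
  ext1 ψ
  refine ext_inner_left ℂ fun φ => ?_
  rw [add_apply, inner_add_right, inner_jointObservable ha,
    inner_jointObservable ha, inner_jointObservable ha, ← mul_add,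
    integral_add_compl hB (integral_inner_translate ha φ ψ).1, Measure.restrict_univ]

theorem translate_nonneg (ha : 0 ≤ a) (z : Space N × Space N) : 0 ≤ translate a z := by
  rw [ContinuousLinearMap.nonneg_iff_isPositive] at ha ⊢
  exact ha.conj_adjoint (weyl z.1 z.2)

theorem jointObservable_nonneg (ha : IsDensityOperator a) (B : Set (Space N × Space N)) :
    0 ≤ jointObservable a B := by
  rw [ContinuousLinearMap.nonneg_iff_isPositive, ContinuousLinearMap.isPositive_iff_complex]
  intro φ
  -- The positivity criterion concerns ⟨Tφ, φ⟩, the weak integral ⟨φ, Tφ⟩; both agree since the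
  -- values are real.
  have h0 : ∀ z, 0 ≤ (⟪φ, translate a z φ⟫_ℂ).re ∧
      (((⟪φ, translate a z φ⟫_ℂ).re : ℝ) : ℂ) = ⟪φ, translate a z φ⟫_ℂ := fun z => by
    have h := translate_nonneg ha.nonneg z
    rw [ContinuousLinearMap.nonneg_iff_isPositive, ContinuousLinearMap.isPositive_iff_complex] at h
    obtain ⟨h1, h2⟩ := h φ
    rw [← inner_conj_symm, ← h1]
    simp only [RCLike.re_to_complex] at h2 ⊢
    simp [h2]
  have h3 : ⟪φ, jointObservable a B φ⟫_ℂ =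
      ((((2 * Real.pi) ^ N)⁻¹ * ∫ z in B, (⟪φ, translate a z φ⟫_ℂ).re : ℝ) : ℂ) := by
    rw [inner_jointObservable ha, Complex.ofReal_mul, ← integral_complex_ofReal]
    simp only [(h0 _).2]
  have h4 : 0 ≤ ((2 * Real.pi) ^ N)⁻¹ * ∫ z in B, (⟪φ, translate a z φ⟫_ℂ).re := by
    have := Real.pi_pos
    exact mul_nonneg (by positivity) (integral_nonneg fun z => (h0 z).1)
  rw [← inner_conj_symm, h3]
  simp only [Complex.conj_ofReal, RCLike.re_to_complex, Complex.ofReal_re]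
  exact ⟨trivial, h4⟩

/-- The overlap `z ↦ tr (W a_z)` is integrable, and its integrals give the distribution of the
joint observable in the state `W`. -/
theorem trace_comp_jointObservable (ha : IsDensityOperator a) (hW : IsDensityOperator W) :
    Integrable (fun z => trace (W ∘L translate a z)) ∧
      ∀ B, trace (W ∘L jointObservable a B) =
        (((2 * Real.pi) ^ N)⁻¹ : ℝ) * ∫ z in B, trace (W ∘L translate a z) := by
  obtain ⟨s, w, hc, hw⟩ := hW.exists_isEnsemble
  have hint := fun i => integral_inner_translate ha (w i) (w i)
  have hs : Summable fun i => ∫ z, ‖⟪w i, translate a z (w i)⟫_ℂ‖ := by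
    refine Summable.of_nonneg_of_le (fun i => integral_nonneg fun z => norm_nonneg _)
      (fun i => (hint i).2.2) ?_
    simpa only [← sq] using hw.hasSum_norm_sq.summable.mul_left ((2 * Real.pi) ^ N)
  refine ⟨(integral_hasSum_of_summable_integral_norm (fun i => (hint i).1) hs
    (fun z => hw.hasSum_trace (translate a z))).1, fun B => ?_⟩
  have hB := integral_hasSum_of_summable_integral_norm (μ := volume.restrict B)
    (fun i => (hint i).1.restrict) (Summable.of_nonneg_of_le
      (fun i => integral_nonneg fun z => norm_nonneg _)
      (fun i => setIntegral_le_integral (hint i).1.norm (.of_forall fun _ => norm_nonneg _)) hs)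
    (fun z => hw.hasSum_trace (translate a z))
  refine (hw.hasSum_trace _).unique ?_
  simp only [inner_jointObservable ha]
  exact hB.2.1.mul_left _

theorem isObservable_jointObservable (ha : IsDensityOperator a) :
    IsObservable (jointObservable a) where
  effect B hB := ⟨jointObservable_nonneg ha B, by
    rw [← jointObservable_add_compl ha hB]
    -- F(B) ≤ 1 is positivity of F(Bᶜ), because F(B) + F(Bᶜ) = 1.
    exact le_add_of_nonneg_right (jointObservable_nonneg ha Bᶜ)⟩
  empty := jointObservable_empty ha
  univ := jointObservable_univ ha
  iUnion B hB hd W hW := by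
    obtain ⟨h1, h2⟩ := trace_comp_jointObservable ha hW
    simp only [h2]
    exact (hasSum_integral_iUnion hB hd h1.integrableOn).mul_left _

end Observable

/-! ### Weyl transforms and statistical completeness. -/

section Completeness

open scoped ComplexConjugate

variable {N : ℕ} {a W : WaveSpace N →L[ℂ] WaveSpace N}

/-- The symplectic character of phase space. -/
def weylPhase (ζ z : Space N × Space N) : ℂ :=
  Complex.exp (Complex.I * ((⟪z.2, ζ.1⟫_ℝ - ⟪ζ.2, z.1⟫_ℝ : ℝ) : ℂ))

theorem norm_weylPhase (ζ z : Space N × Space N) : ‖weylPhase ζ z‖ = 1 := by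
  rw [weylPhase, mul_comm]; exact Complex.norm_exp_ofReal_mul_I _

theorem continuous_weylPhase (ζ : Space N × Space N) : Continuous (weylPhase ζ) := by
  unfold weylPhase
  fun_prop

/-- The Weyl relations. -/
theorem weyl_weyl (ζ z : Space N × Space N) (u : WaveSpace N) :
    weyl z.1 z.2 (weyl ζ.1 ζ.2 u) = weylPhase ζ z • weyl ζ.1 ζ.2 (weyl z.1 z.2 u) := by
  refine Lp.ext ?_
  filter_upwards [weyl_ae_eq z.1 z.2 (weyl ζ.1 ζ.2 u),
    (measurePreserving_sub_right volume z.1).quasiMeasurePreserving.ae (weyl_ae_eq ζ.1 ζ.2 u),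
    Lp.coeFn_smul (weylPhase ζ z) (weyl ζ.1 ζ.2 (weyl z.1 z.2 u)),
    weyl_ae_eq ζ.1 ζ.2 (weyl z.1 z.2 u),
    (measurePreserving_sub_right volume ζ.1).quasiMeasurePreserving.ae (weyl_ae_eq z.1 z.2 u)]
    with x h1 h2 h3 h4 h5
  rw [h1, h2, h3, Pi.smul_apply, h4, h5, smul_eq_mul, weylPhase, sub_right_comm]
  simp only [← mul_assoc, ← Complex.exp_add]
  congr 2
  simp only [inner_sub_right]
  push_cast
  ring

theorem weylPhase_mul_ambiguity (ζ z : Space N × Space N) (φ f : WaveSpace N) :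
    weylPhase ζ z * ambiguity φ f z =
      ambiguity (weyl ζ.1 ζ.2 φ) (weyl ζ.1 ζ.2 f) z := by
  rw [ambiguity, ambiguity, weyl_weyl, inner_smul_right]
  congr 1
  exact ((weylIsometry ζ.1 ζ.2).inner_map_map _ _).symm

/-- The character is absorbed into one factor of each term, where it acts as U_ζ on w and fᵢ. Moyal
then gives ⟨U_ζ w, w⟩⟨fᵢ, U_ζ fᵢ⟩, and the sum over i is the trace with a. -/
theorem integral_weylPhase_mul_inner (ha : IsDensityOperator a) (ζ : Space N × Space N)
    (w : WaveSpace N) :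
    ∫ z, weylPhase ζ z * ⟪w, translate a z w⟫_ℂ =
      ((2 * Real.pi) ^ N : ℝ) * (⟪weyl ζ.1 ζ.2 w, w⟫_ℂ * trace (a ∘L weyl ζ.1 ζ.2)) := by
  obtain ⟨s, f, hc, hf⟩ := ha.exists_isEnsemble
  have h1 := (hf.summable_integral_norm_ambiguity w w).1
  obtain ⟨-, h4, -⟩ := integral_hasSum_of_summable_integral_norm
    (F := fun i z => ambiguity (weyl ζ.1 ζ.2 w) (weyl ζ.1 ζ.2 (f i)) z * conj (ambiguity w (f i) z))
    (G := fun z => weylPhase ζ z * ⟪w, translate a z w⟫_ℂ)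
    (fun i => integrable_ambiguity_mul_conj _ _ _ _)
    (by simpa only [← weylPhase_mul_ambiguity, norm_mul, RCLike.norm_conj, norm_weylPhase,
      one_mul] using h1)
    (fun z => by
      simpa only [← weylPhase_mul_ambiguity, mul_assoc] using
        (hf.hasSum_inner_translate w w z).mul_left (weylPhase ζ z))
  refine h4.unique ?_
  simp only [integral_ambiguity_mul_conj]
  exact ((hf.hasSum_trace (weyl ζ.1 ζ.2)).mul_left _).mul_left _

/-- The symplectic Fourier transform of `z ↦ tr (W a_z)` is the product of the Weyl transforms of
`W` and `a`. -/
theorem integral_weylPhase_mul_trace (ha : IsDensityOperator a) (hW : IsDensityOperator W)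
    (ζ : Space N × Space N) :
    ∫ z, weylPhase ζ z * trace (W ∘L translate a z) =
      ((2 * Real.pi) ^ N : ℝ) * (conj (trace (W ∘L weyl ζ.1 ζ.2)) *
        trace (a ∘L weyl ζ.1 ζ.2)) := by
  obtain ⟨s, w, hc, hw⟩ := hW.exists_isEnsemble
  have hint := fun i => integral_inner_translate ha (w i) (w i)
  obtain ⟨-, h4, -⟩ := integral_hasSum_of_summable_integral_norm
    (F := fun i z => weylPhase ζ z * ⟪w i, translate a z (w i)⟫_ℂ)
    (fun i => (hint i).1.bdd_mul (c := 1) (continuous_weylPhase ζ).aestronglyMeasurable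
      (.of_forall fun z => (norm_weylPhase ζ z).le))
    (by
      simp only [norm_mul, norm_weylPhase, one_mul]
      refine Summable.of_nonneg_of_le (fun i => integral_nonneg fun z => norm_nonneg _)
        (fun i => (hint i).2.2) ?_
      simpa only [← sq] using hw.hasSum_norm_sq.summable.mul_left ((2 * Real.pi) ^ N))
    (fun z => (hw.hasSum_trace (translate a z)).mul_left (weylPhase ζ z))
  refine h4.unique ?_
  simp only [integral_weylPhase_mul_inner ha]
  refine HasSum.mul_left _ (HasSum.mul_right _ ?_)
  have h5 := Complex.hasSum_conj'.2 (hw.hasSum_trace (weyl ζ.1 ζ.2))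
  simpa only [inner_conj_symm] using h5

/-- Inversion of the Weyl transform, in the weak sense. -/
theorem integral_trace_weyl_mul_conj (hW : IsDensityOperator W) (φ ψ : WaveSpace N) :
    ∫ z : Space N × Space N, trace (W ∘L weyl z.1 z.2) * conj (ambiguity φ ψ z) =
      ((2 * Real.pi) ^ N : ℝ) * ⟪ψ, W φ⟫_ℂ := by
  obtain ⟨s, w, hc, hw⟩ := hW.exists_isEnsemble
  obtain ⟨-, h4, -⟩ := integral_hasSum_of_summable_integral_norm
    (F := fun i z => ambiguity (w i) (w i) z * conj (ambiguity φ ψ z))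
    (fun i => integrable_ambiguity_mul_conj _ _ _ _)
    (by
      simp only [norm_mul, RCLike.norm_conj]
      refine Summable.of_nonneg_of_le
        (fun i => integral_nonneg fun z => mul_nonneg (norm_nonneg _) (norm_nonneg _))
        (fun i => integral_norm_ambiguity_mul_le _ _ _ _) ?_
      simpa only [← sq] using
        (hw.hasSum_norm_sq.summable.mul_right (‖φ‖ * ‖ψ‖)).mul_left ((2 * Real.pi) ^ N))
    (fun z => (hw.hasSum_trace (weyl z.1 z.2)).mul_right (conj (ambiguity φ ψ z)))
  refine h4.unique ?_
  simp only [integral_ambiguity_mul_conj]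
  refine HasSum.mul_left _ ?_
  -- Moyal turns the i-th term into ⟨wᵢ,φ⟩⟨ψ,wᵢ⟩, whose sum is a matrix element of W.
  simpa only [mul_comm] using hw.hasSum_inner ψ φ

theorem isStatisticallyComplete_jointObservable (ha : IsDensityOperator a)
    (h : ∀ᵐ z : Space N × Space N, trace (a ∘L weyl z.1 z.2) ≠ 0) :
    IsStatisticallyComplete (jointObservable a) := by
  intro W₁ W₂ h₁ h₂ hF
  have hc : (((2 * Real.pi) ^ N : ℝ) : ℂ) ≠ 0 := by
    have := Real.pi_pos
    exact_mod_cast (by positivity : (2 * Real.pi) ^ N ≠ 0)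
  obtain ⟨i₁, t₁⟩ := trace_comp_jointObservable ha h₁
  obtain ⟨i₂, t₂⟩ := trace_comp_jointObservable ha h₂
  have e1 : (fun z => trace (W₁ ∘L translate a z)) =ᵐ[volume]
      fun z => trace (W₂ ∘L translate a z) := by
    -- Equal distributions mean equal integrals over all Borel sets, hence densities equal almost
    -- everywhere.
    refine Integrable.ae_eq_of_forall_setIntegral_eq _ _ i₁ i₂ fun B hB _ => ?_
    have := hF B hB
    rw [t₁, t₂, Complex.ofReal_inv] at this
    exact mul_left_cancel₀ (inv_ne_zero hc) this
  have e2 : (fun z : Space N × Space N => trace (W₁ ∘L weyl z.1 z.2)) =ᵐ[volume]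
      fun z => trace (W₂ ∘L weyl z.1 z.2) := by
    filter_upwards [h] with ζ hζ
    have h3 : ∫ z, weylPhase ζ z * trace (W₁ ∘L translate a z) =
        ∫ z, weylPhase ζ z * trace (W₂ ∘L translate a z) :=
      integral_congr_ae (e1.mono fun z hz => congrArg (weylPhase ζ z * ·) hz)
    rw [integral_weylPhase_mul_trace ha h₁, integral_weylPhase_mul_trace ha h₂] at h3
    -- The nonvanishing of tr(a U_ζ) enters only here, to cancel it.
    exact (starRingEnd ℂ).injective (mul_right_cancel₀ hζ (mul_left_cancel₀ hc h3))
  ext1 φ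
  refine ext_inner_left ℂ fun ψ => mul_left_cancel₀ hc ?_
  rw [← integral_trace_weyl_mul_conj h₁, ← integral_trace_weyl_mul_conj h₂]
  exact integral_congr_ae (e2.mono fun z hz => congrArg (· * conj (ambiguity φ ψ z)) hz)

end Completeness

/-! ### The Gaussian state and its nonvanishing Weyl transform. -/

section Gaussian

open scoped ComplexConjugate

variable {N : ℕ}

theorem integral_euclideanSpace_prod {ι : Type*} [Fintype ι] (f : ι → ℝ → ℂ) :
    ∫ x : EuclideanSpace ℝ ι, ∏ j, f j (x j) = ∏ j, ∫ t, f j t := by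
  rw [← integral_fintype_prod_volume_eq_prod]
  exact (PiLp.volume_preserving_ofLp ι).integral_comp
    (MeasurableEquiv.toLp 2 (ι → ℝ)).symm.measurableEmbedding fun y => ∏ j, f j (y j)

/-- The normalized one-dimensional Gaussian wave function. -/
def gaussianFactor (s t : ℝ) : ℝ :=
  (2 * Real.pi * s ^ 2) ^ (-(1 / 4) : ℝ) * Real.exp (-t ^ 2 / (4 * s ^ 2))

theorem integral_gaussianFactor_sq {s : ℝ} (hs : 0 < s) :
    ∫ t, gaussianFactor s t * gaussianFactor s t = 1 := by
  have hp := Real.pi_pos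
  have hc : 0 < 2 * Real.pi * s ^ 2 := by positivity
  have e : ∀ t, gaussianFactor s t * gaussianFactor s t =
      (2 * Real.pi * s ^ 2) ^ (-(1 / 2) : ℝ) * Real.exp (-(1 / (2 * s ^ 2)) * t ^ 2) := fun t => by
    rw [gaussianFactor, mul_mul_mul_comm, ← Real.rpow_add hc, ← Real.exp_add]
    congr 2
    · norm_num
    · field_simp
      ring
  simp_rw [e]
  rw [integral_const_mul, integral_gaussian, Real.sqrt_eq_rpow,
    show Real.pi / (1 / (2 * s ^ 2)) = 2 * Real.pi * s ^ 2 by field_simp, ← Real.rpow_add hc]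
  norm_num

/-- The integrand is a nonzero constant times the exponential of a complex quadratic polynomial with
negative leading coefficient; its integral is a nonzero power times an exponential. -/
theorem integral_gaussianFactor_mul_exp_ne_zero {s : ℝ} (hs : 0 < s) (q p : ℝ) :
    ∫ t : ℝ, (gaussianFactor s t : ℂ) * (Complex.exp (Complex.I * ((p * t : ℝ) : ℂ)) *
      (gaussianFactor s (t - q) : ℂ)) ≠ 0 := by
  have hp := Real.pi_pos
  have hc : 0 < 2 * Real.pi * s ^ 2 := by positivity
  have hC : (((2 * Real.pi * s ^ 2) ^ (-(1 / 4) : ℝ) : ℝ) : ℂ) ≠ 0 := by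
    exact_mod_cast (Real.rpow_pos_of_pos hc _).ne'
  have hs' : (s : ℂ) ≠ 0 := by exact_mod_cast hs.ne'
  have e : ∀ t : ℝ, (gaussianFactor s t : ℂ) * (Complex.exp (Complex.I * ((p * t : ℝ) : ℂ)) *
      (gaussianFactor s (t - q) : ℂ)) =
      (((2 * Real.pi * s ^ 2) ^ (-(1 / 4) : ℝ) : ℝ) : ℂ) ^ 2 *
        Complex.exp ((-(1 / (2 * s ^ 2)) : ℝ) * (t : ℂ) ^ 2 +
          (q / (2 * s ^ 2) + Complex.I * p) * t + -(q : ℂ) ^ 2 / (4 * s ^ 2)) := fun t => by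
    simp only [gaussianFactor, Complex.ofReal_mul, Complex.ofReal_exp]
    rw [show ∀ A B C D : ℂ, A * B * (C * (A * D)) = A ^ 2 * (B * (C * D)) by intros; ring,
      ← Complex.exp_add, ← Complex.exp_add]
    congr 2
    push_cast
    field_simp
    ring
  have hb : ((-(1 / (2 * s ^ 2)) : ℝ) : ℂ).re < 0 := by
    rw [Complex.ofReal_re, neg_lt_zero]
    positivity
  simp_rw [e]
  rw [integral_const_mul, integral_cexp_quadratic hb]
  refine mul_ne_zero (pow_ne_zero 2 hC) (mul_ne_zero ?_ (Complex.exp_ne_zero _))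
  rw [Ne, Complex.cpow_eq_zero_iff, not_and_or]
  left
  refine div_ne_zero (by exact_mod_cast hp.ne') (neg_ne_zero.2 fun h => ?_)
  rw [h] at hb
  simp at hb

theorem norm_gaussianState {σ : Fin N → ℝ} (hσ : ∀ j, 0 < σ j) : ‖gaussianState hσ‖ = 1 := by
  have h : ⟪gaussianState hσ, gaussianState hσ⟫_ℂ = 1 := by
    rw [L2.inner_def]
    have e : ∀ᵐ x : Space N, ⟪gaussianState hσ x, gaussianState hσ x⟫_ℂ =
        ∏ j, ((gaussianFactor (σ j) (x j) * gaussianFactor (σ j) (x j) : ℝ) : ℂ) := by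
      filter_upwards [(memLp_gaussianWave hσ).coeFn_toLp] with x hx
      rw [gaussianState, hx, RCLike.inner_apply, Complex.conj_ofReal, ← Complex.ofReal_mul,
        ← Complex.ofReal_prod, Finset.prod_mul_distrib]
      rfl
    rw [integral_congr_ae e, integral_euclideanSpace_prod
      (fun j t => ((gaussianFactor (σ j) t * gaussianFactor (σ j) t : ℝ) : ℂ))]
    refine Finset.prod_eq_one fun j _ => ?_
    rw [integral_complex_ofReal, integral_gaussianFactor_sq (hσ j), Complex.ofReal_one]
  have h2 : ‖gaussianState hσ‖ ^ 2 = 1 := by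
    rw [← inner_self_eq_norm_sq (𝕜 := ℂ), h, RCLike.one_re]
  exact (pow_eq_one_iff_of_nonneg (norm_nonneg _) two_ne_zero).1 h2

theorem gaussianWave_eq_prod (σ : Fin N → ℝ) (x : Space N) :
    (gaussianWave σ x : ℂ) = ∏ j, (gaussianFactor (σ j) (x j) : ℂ) :=
  Complex.ofReal_prod _ _

theorem phase_eq_prod (p x : Space N) : Complex.exp (Complex.I * (⟪p, x⟫_ℝ : ℂ)) =
    ∏ j, Complex.exp (Complex.I * ((p j * x j : ℝ) : ℂ)) := by
  rw [← Complex.exp_sum, ← Finset.mul_sum, ← Complex.ofReal_sum, PiLp.inner_apply]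
  simp only [RCLike.inner_apply, conj_trivial, mul_comm]

/-- Gaussian and phase both factor over the coordinates, so the matrix element is a product of
nonzero one-dimensional integrals. -/
theorem ambiguity_gaussianState_ne_zero {σ : Fin N → ℝ} (hσ : ∀ j, 0 < σ j)
    (z : Space N × Space N) : ambiguity (gaussianState hσ) (gaussianState hσ) z ≠ 0 := by
  have hu := (memLp_gaussianWave hσ).coeFn_toLp
  have e : ∀ᵐ x : Space N, ⟪gaussianState hσ x, weyl z.1 z.2 (gaussianState hσ) x⟫_ℂ =
      ∏ j, ((gaussianFactor (σ j) (x j) : ℂ) *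
        (Complex.exp (Complex.I * ((z.2 j * x j : ℝ) : ℂ)) *
          (gaussianFactor (σ j) (x j - z.1 j) : ℂ))) := by
    filter_upwards [hu, weyl_ae_eq z.1 z.2 (gaussianState hσ),
      (measurePreserving_sub_right volume z.1).quasiMeasurePreserving.ae hu] with x h1 h2 h3
    rw [h2, RCLike.inner_apply]
    unfold gaussianState
    rw [h1, h3, Complex.conj_ofReal, gaussianWave_eq_prod,
      gaussianWave_eq_prod, phase_eq_prod, Finset.prod_mul_distrib, Finset.prod_mul_distrib]
    exact mul_comm _ _
  rw [ambiguity, L2.inner_def, integral_congr_ae e, integral_euclideanSpace_prod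
    (fun j t => (gaussianFactor (σ j) t : ℂ) *
        (Complex.exp (Complex.I * ((z.2 j * t : ℝ) : ℂ)) *
          (gaussianFactor (σ j) (t - z.1 j) : ℂ)))]
  exact Finset.prod_ne_zero_iff.2 fun j _ =>
    integral_gaussianFactor_mul_exp_ne_zero (hσ j) (z.1 j) (z.2 j)

theorem trace_pureState_weyl {u : WaveSpace N} (hu : ‖u‖ = 1) (q p : Space N) :
    trace (pureState u ∘L weyl q p) = ambiguity u u (q, p) :=
  ((isEnsemble_rankOne hu).hasSum_trace (weyl q p)).unique
    (hasSum_unique (fun _ : Unit => ambiguity u u (q, p)) _)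

end Gaussian

end PhaseSpace

end

theorem theorem7p4 (N : ℕ) :
    (∀ a : PhaseSpace.WaveSpace N →L[ℂ] PhaseSpace.WaveSpace N, PhaseSpace.IsDensityOperator a →
      (∀ B : Set (PhaseSpace.Space N × PhaseSpace.Space N), MeasurableSet B →
        ∃ A, PhaseSpace.HasWeakIntegral (volume.restrict B) (PhaseSpace.translate a) A) ∧
      PhaseSpace.IsObservable (PhaseSpace.jointObservable a) ∧
      ((∀ᵐ z : PhaseSpace.Space N × PhaseSpace.Space N,
          PhaseSpace.trace (a ∘L PhaseSpace.weyl z.1 z.2) ≠ 0) →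
        PhaseSpace.IsStatisticallyComplete (PhaseSpace.jointObservable a))) ∧
    (∀ (σ : Fin N → ℝ) (hσ : ∀ j, 0 < σ j),
      PhaseSpace.IsDensityOperator (PhaseSpace.pureState (PhaseSpace.gaussianState hσ)) ∧
      (∀ q p : PhaseSpace.Space N,
        PhaseSpace.trace (PhaseSpace.pureState (PhaseSpace.gaussianState hσ) ∘L
          PhaseSpace.weyl q p) ≠ 0) ∧
      PhaseSpace.IsStatisticallyComplete
        (PhaseSpace.jointObservable
          (PhaseSpace.pureState (PhaseSpace.gaussianState hσ)))) := by
  refine ⟨fun a ha => ⟨fun B _ => PhaseSpace.exists_hasWeakIntegral_translate ha B,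
    PhaseSpace.isObservable_jointObservable ha,
    PhaseSpace.isStatisticallyComplete_jointObservable ha⟩, fun σ hσ => ?_⟩
  have hu := PhaseSpace.norm_gaussianState hσ
  have hd : PhaseSpace.IsDensityOperator (PhaseSpace.pureState (PhaseSpace.gaussianState hσ)) :=
    PhaseSpace.isDensityOperator_rankOne hu
  have ht : ∀ q p : PhaseSpace.Space N,
      PhaseSpace.trace (PhaseSpace.pureState (PhaseSpace.gaussianState hσ) ∘L
        PhaseSpace.weyl q p) ≠ 0 := fun q p => by
    rw [PhaseSpace.trace_pureState_weyl hu]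
    exact PhaseSpace.ambiguity_gaussianState_ne_zero hσ (q, p)
  exact ⟨hd, ht, PhaseSpace.isStatisticallyComplete_jointObservable hd
    (.of_forall fun z => ht z.1 z.2)⟩
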